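/- Notation. A convex body in $\mathbb{R}^n$ is a compact convex set with nonempty interior. A set $K\subseteq\mathbb{R}^n$ is unconditional if it is invariant under the reflections $x_i\mapsto -x_i$ in all coordinate hyperplanes. Throughout, $0^0=1$. For a nonnegative integrable $\varphi:\mathbb{R}\to\mathbb{R}$ with positive integral, its inverse distribution (i.d.) function is $u(t)=\inf\{s\in\mathbb{R}:\int_{-\infty}^s\varphi>t\int_{\mathbb{R}}\varphi\}$, $t\in(0,1)$. For a convex body $K$ in $\mathbb{R}^n$ with characteristic function $\chi_K$, its $(e_1,\dots,e_n)$-i.d. field is $U(t)=(u_1(t_1),u_2(t_1,t_2),\dots,u_n(t_1,\dots,t_n))$, $t\in(0,1)^n$, where, recursively, $t_i\mapsto u_i(t_1,\dots,t_i)$ is the i.d. function of $$x_i\mapsto\int_{\mathbb{R}^{n-i}}\chi_K\big(u_1(t_1),\dots,u_{i-1}(t_1,\dots,t_{i-1}),x_i,x_{i+1},\dots,x_n\big)\,dx_{i+1}\cdots dx_n .$$ Let $U$, $V$ be the i.d. fields of two convex bodies $K$, $L$, and let $\lambda\in[0,1]$. The standard geometric potential $W_\lambda=(w_{\lambda,1},\dots,w_{\lambda,n})$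 is given by $$w_{\lambda,i}(t_1,\dots,t_i)=\int_{1/2}^{t_i}\Big(\frac{\partial u_i}{\partial t_i}(t_1,\dots,t_{i-1},s)\Big)^{1-\lambda}\Big(\frac{\partial v_i}{\partial t_i}(t_1,\dots,t_{i-1},s)\Big)^{\lambda}ds .$$ The standard $(e_1,\dots,e_n)$-geometric combination $K\star_\lambda L$ is the set whose characteristic function takes the value $\chi_K(U(t))^{1-\lambda}\chi_L(V(t))^{\lambda}$ at $x=W_\lambda(t)$, $t\in(0,1)^n$, and the value $0$ off the image of $W_\lambda$. Finally, $$K^{1-\lambda}\cdot L^\lambda=\{z\in\mathbb{R}^n:\ \exists\,x\in K,\ y\in L\ \text{ such that } |z_i|=|x_i|^{1-\lambda}|y_i|^{\lambda}\ \text{ for all } i\},$$ $$(1-\lambda)\cdot K+_0\lambda\cdot L=\{x\in\mathbb{R}^n:\ x\cdot\xi\le h_K(\xi)^{1-\lambda}h_L(\xi)^{\lambda}\ \text{ for all } \xi\in S^{n-1}\},$$ where $h_K(\xi)=\sup_{x\in K}x\cdot\xi$, and $|\cdot|$ of a set denotes Lebesgue measure. Proposition. Let $K$ and $L$ be unconditional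 convex bodies in $\mathbb{R}^n$ and let $\lambda\in[0,1]$. Then: (i) $K\star_\lambda L$ is an unconditional set; (ii) $K\star_\lambda L\subseteq K^{1-\lambda}\cdot L^\lambda\subseteq(1-\lambda)\cdot K+_0\lambda\cdot L$; in particular $K\star_\lambda L\subseteq(1-\lambda)\cdot K+_0\lambda\cdot L$. Moreover, $K\star_\lambda L$ is Lebesgue measurable with $|K\star_\lambda L|=|K|^{1-\lambda}|L|^\lambda$, and consequently the log-Brunn–Minkowski inequality holds: $$|(1-\lambda)\cdot K+_0\lambda\cdot L|\ \ge\ |K|^{1-\lambda}|L|^\lambda .$$ -/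

import Mathlib

noncomputable section

open MeasureTheory Set

namespace GeomComb

/-- The inverse distribution function of `f : ℝ → ℝ`: the generalized inverse of its normalized
distribution function, `u t = inf {s | ∫_{-∞}^s f > t ∫ f}` for `t ∈ (0, 1)`. -/
def idFun (f : ℝ → ℝ) (t : ℝ) : ℝ :=
  sInf {s : ℝ | t * (∫ x, f x) < ∫ x in Iic s, f x}

/-- The inverse distribution field of `f : ℝⁿ → ℝ` with respect to the canonical basis.
Its first component at `t` is `u₁ = idFun (x₁ ↦ ∫ f (x₁, x₂, …, xₙ) dx₂ … dxₙ) t₁`, and the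
remaining components `u₂, …, uₙ` are those of the inverse distribution field of the restriction
`(x₂, …, xₙ) ↦ f (u₁, x₂, …, xₙ)`, evaluated at `(t₂, …, tₙ)`. Unfolding the recursion,
`uᵢ (t₁, …, tᵢ₋₁, ·)` is the inverse distribution function of
`xᵢ ↦ ∫ f (u₁, …, uᵢ₋₁, xᵢ, xᵢ₊₁, …, xₙ) dxᵢ₊₁ … dxₙ`. -/
def idField : {n : ℕ} → ((Fin n → ℝ) → ℝ) → (Fin n → ℝ) → (Fin n → ℝ)
  | 0, _, _ => Fin.elim0
  | n + 1, f, t =>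
    let u₁ : ℝ := idFun (fun s => ∫ y : Fin n → ℝ, f (Fin.cons s y)) (t 0)
    Fin.cons u₁ (idField (fun y : Fin n → ℝ => f (Fin.cons u₁ y)) (Fin.tail t))

/-- The standard geometric primitive of `(u, v)` in proportion `lam`: the primitive of
`(u')^(1 - lam) (v')^lam` which vanishes at `1/2`. -/
def stdPrimitive (lam : ℝ) (u v : ℝ → ℝ) (t : ℝ) : ℝ :=
  ∫ s in (1 / 2 : ℝ)..t, deriv u s ^ (1 - lam) * deriv v s ^ lam

/-- The standard geometric potential of two fields `U`, `V` (whose `i`-th components depend on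
`t₁, …, tᵢ` only): its `i`-th component is, as a function of `tᵢ`, the standard geometric
primitive of `tᵢ ↦ uᵢ (t₁, …, tᵢ)` and `tᵢ ↦ vᵢ (t₁, …, tᵢ)`. -/
def stdPotential {n : ℕ} (lam : ℝ) (U V : (Fin n → ℝ) → (Fin n → ℝ)) (t : Fin n → ℝ) :
    Fin n → ℝ :=
  fun i => stdPrimitive lam (fun s => U (Function.update t i s) i)
    (fun s => V (Function.update t i s) i) (t i)

/-- The open unit cube `(0, 1)ⁿ`. -/
def unitCube (n : ℕ) : Set (Fin n → ℝ) := {t | ∀ i, t i ∈ Ioo (0 : ℝ) 1}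

open Classical in
/-- The standard geometric combination `f ⋆ g` of two functions in proportion `lam`, with respect
to the canonical basis: with `U`, `V` the inverse distribution fields of `f`, `g` and `W` their
standard geometric potential, its value is `f (U t)^(1 - lam) * g (V t)^lam` at `x = W t` with
`t ∈ (0, 1)ⁿ`, and `0` off the image of `W`. -/
def geomComb {n : ℕ} (lam : ℝ) (f g : (Fin n → ℝ) → ℝ) (x : Fin n → ℝ) : ℝ :=
  if h : ∃ t ∈ unitCube n, stdPotential lam (idField f) (idField g) t = x then
    f (idField f h.choose) ^ (1 - lam) * g (idField g h.choose) ^ lam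
  else 0

/-- The characteristic function of a set. -/
def charFn {n : ℕ} (K : Set (Fin n → ℝ)) : (Fin n → ℝ) → ℝ := K.indicator (fun _ => 1)

/-- The standard geometric combination of two sets: the set whose characteristic function is
the standard geometric combination of the two characteristic functions
(see `geomComb_charFn`). -/
def setComb {n : ℕ} (lam : ℝ) (K L : Set (Fin n → ℝ)) : Set (Fin n → ℝ) :=
  {x | geomComb lam (charFn K) (charFn L) x = 1}

theorem geomComb_charFn {n : ℕ} (lam : ℝ) (K L : Set (Fin n → ℝ)) :
    geomComb lam (charFn K) (charFn L) = charFn (setComb lam K L) := by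
  have key : ∀ x, geomComb lam (charFn K) (charFn L) x = 0 ∨
      geomComb lam (charFn K) (charFn L) x = 1 := by
    intro x
    have h01 : ∀ (A : Set (Fin n → ℝ)) (y : Fin n → ℝ) (p : ℝ),
        charFn A y ^ p = 0 ∨ charFn A y ^ p = 1 := by
      intro A y p
      by_cases hy : y ∈ A
      · right; simp [charFn, hy]
      · by_cases hp : p = 0
        · right; simp [hp]
        · left; simp [charFn, hy, Real.zero_rpow hp]
    unfold geomComb
    split_ifs with h
    · rcases h01 K (idField (charFn K) h.choose) (1 - lam) with h1 | h1 <;>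
        rcases h01 L (idField (charFn L) h.choose) lam with h2 | h2 <;> simp [h1, h2]
    · exact Or.inl rfl
  funext x
  rcases key x with h | h
  · simp [charFn, setComb] at h ⊢
    simp [h]
  · simp [charFn, setComb] at h ⊢
    simp [h]

/-- A set is unconditional if it is invariant under the reflections in all the coordinate
hyperplanes. -/
def Unconditional {n : ℕ} (K : Set (Fin n → ℝ)) : Prop :=
  ∀ x ∈ K, ∀ i : Fin n, Function.update x i (-x i) ∈ K

/-- The product body `K^(1 - lam) · L^lam`. -/
def productBody {n : ℕ} (lam : ℝ) (K L : Set (Fin n → ℝ)) : Set (Fin n → ℝ) :=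
  {z | ∃ x ∈ K, ∃ y ∈ L, ∀ i, |z i| = |x i| ^ (1 - lam) * |y i| ^ lam}

/-- The support function `h_K ξ = sup {x · ξ | x ∈ K}`. -/
def supportFn {n : ℕ} (K : Set (Fin n → ℝ)) (ξ : Fin n → ℝ) : ℝ :=
  sSup ((fun x => x ⬝ᵥ ξ) '' K)

/-- The `0`-sum `(1 - lam) · K +₀ lam · L`; here `ξ` ranges over the Euclidean unit sphere. -/
def zeroSum {n : ℕ} (lam : ℝ) (K L : Set (Fin n → ℝ)) : Set (Fin n → ℝ) :=
  {x | ∀ ξ : Fin n → ℝ, ∑ i, ξ i ^ 2 = 1 →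
    x ⬝ᵥ ξ ≤ supportFn K ξ ^ (1 - lam) * supportFn L ξ ^ lam}

end GeomComb

end

/-! Everything is an induction on the dimension through sections orthogonal to the first axis. Let f
and g be the section-volume functions of K and L, and u, v, w the first components of U, V and the
potential W. The section of K ⋆ L over w(t) is the combination of the sections of K at u(t) and of L
at v(t), which are again unconditional bodies (`mem_setComb_succ`, `sec_setComb`).

Unconditionality: f and g are even, so u, v and w are odd about t = 1/2, and opposite sections
coincide.

Inclusions: u' and v' are positive with primitives u and v vanishing at 1/2, so Hölder gives |w| ≤
|u|^(1-lam) |v|^lam (`abs_stdPrimitive_le`). Solidity of K and L then allows the points to be shrunk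
to equality, which gives the product body. Hölder for finite sums, with a choice of signs in the
support functions, puts the product body into the 0-sum.

Volume: u' = |K| / f(u) and v' = |L| / g(v). By induction the section over w(t) has volume
f(u)^(1-lam) g(v)^lam, and multiplying by w' leaves the constant |K|^(1-lam) |L|^lam
(`ofReal_geomDeriv_mul`). Fubini and the substitution s = w(t) conclude. Fubini needs K ⋆ L
measurable: it is the injective measurable image of the cube. -/

noncomputable section

open MeasureTheory Set Filter Topology
open scoped Pointwise

namespace GeomComb

/-! ### Inverse distribution functions of even profiles on the line -/

/-- An even nonnegative integrable function, positive and continuous on `(-a, a)` and vanishing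
off `[-a, a]`. -/
structure IsProfile (F : ℝ → ℝ) (a : ℝ) : Prop where
  a_pos : 0 < a
  even : ∀ s, F (-s) = F s
  nonneg : ∀ s, 0 ≤ F s
  pos : ∀ s ∈ Ioo (-a) a, 0 < F s
  zero : ∀ s, a < |s| → F s = 0
  cont : ContinuousOn F (Ioo (-a) a)
  int : Integrable F

/-- The (unnormalized) distribution function. -/
def cdf (F : ℝ → ℝ) (s : ℝ) : ℝ := ∫ x in Iic s, F x

theorem cdf_sub {F : ℝ → ℝ} (hF : Integrable F) (s s' : ℝ) :
    cdf F s' - cdf F s = ∫ x in s..s', F x :=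
  intervalIntegral.integral_Iic_sub_Iic hF.integrableOn hF.integrableOn

theorem cdf_mono {F : ℝ → ℝ} (hF : Integrable F) (h0 : ∀ s, 0 ≤ F s) : Monotone (cdf F) := by
  intro s s' h
  have := cdf_sub hF s s'
  have := intervalIntegral.integral_nonneg (μ := volume) h (fun x _ => h0 x)
  linarith

theorem cdf_continuous {F : ℝ → ℝ} (hF : Integrable F) : Continuous (cdf F) := by
  have : cdf F = fun s => cdf F 0 + ∫ x in (0 : ℝ)..s, F x := by
    funext s; rw [← cdf_sub hF]; ring
  rw [this]
  exact continuous_const.add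
    (intervalIntegral.continuous_primitive (fun a b => hF.intervalIntegrable) 0)

namespace IsProfile

variable {F : ℝ → ℝ} {a : ℝ}

theorem cdf_neg (h : IsProfile F a) (s : ℝ) : cdf F (-s) = (∫ x, F x) - cdf F s := by
  have h1 := integral_comp_neg_Iic (-s) F
  simp only [h.even, neg_neg] at h1
  have h2 := setIntegral_union (f := F) (μ := volume) (Iic_disjoint_Ioi (le_refl s))
    measurableSet_Ioi h.int.integrableOn h.int.integrableOn
  rw [Iic_union_Ioi, setIntegral_univ] at h2
  unfold cdf
  rw [h1, h2]; ring

theorem cdf_neg_a (h : IsProfile F a) : cdf F (-a) = 0 := by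
  unfold cdf
  rw [integral_Iic_eq_integral_Iio]
  refine setIntegral_eq_zero_of_forall_eq_zero fun x hx => h.zero x ?_
  have : x < -a := hx
  rw [abs_of_neg (by linarith [h.a_pos])]; linarith

theorem cdf_a (h : IsProfile F a) : cdf F a = ∫ x, F x := by
  have := h.cdf_neg a
  rw [h.cdf_neg_a] at this; linarith

theorem cdf_mono (h : IsProfile F a) : Monotone (cdf F) := GeomComb.cdf_mono h.int h.nonneg

theorem cdf_lt (h : IsProfile F a) {s s' : ℝ} (hs : -a ≤ s) (hs' : s < a) (hlt : s < s') :
    cdf F s < cdf F s' := by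
  -- `s'` may lie beyond `a`, where `F` vanishes; the strict gain comes from the part up to `a`.
  have key : cdf F s < cdf F (min s' a) := by
    have h1 := cdf_sub h.int s (min s' a)
    have h2 : 0 < ∫ x in s..(min s' a), F x :=
      intervalIntegral.intervalIntegral_pos_of_pos_on h.int.intervalIntegrable
        (fun x hx => h.pos x ⟨lt_of_le_of_lt hs hx.1, lt_of_lt_of_le hx.2 (min_le_right _ _)⟩)
        (lt_min hlt hs')
    linarith
  exact key.trans_le (h.cdf_mono (min_le_left _ _))

theorem integral_pos (h : IsProfile F a) : 0 < ∫ x, F x := by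
  have := h.cdf_lt le_rfl (by linarith [h.a_pos]) (by linarith [h.a_pos] : -a < a)
  rwa [h.cdf_a, h.cdf_neg_a] at this

/-- `F` is positive throughout `(-a, a)`, so the distribution function has no flat piece at `s` and
the infimum is taken over exactly the open ray beyond `s`. -/
theorem idFun_eq (h : IsProfile F a) {s t : ℝ} (hs : s ∈ Ioo (-a) a)
    (hst : cdf F s = t * ∫ x, F x) : idFun F t = s := by
  have : {s' : ℝ | t * (∫ x, F x) < ∫ x in Iic s', F x} = Ioi s := by
    ext s'
    change t * (∫ x, F x) < cdf F s' ↔ s < s'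
    rw [← hst]
    exact ⟨fun hlt => h.cdf_mono.reflect_lt hlt, fun hlt => h.cdf_lt hs.1.le hs.2 hlt⟩
  unfold idFun
  rw [this, csInf_Ioi]

theorem exists_cdf_eq (h : IsProfile F a) {t : ℝ} (ht : t ∈ Ioo (0 : ℝ) 1) :
    ∃ s ∈ Ioo (-a) a, cdf F s = t * ∫ x, F x := by
  have hI := h.integral_pos
  refine intermediate_value_Ioo (by linarith [h.a_pos]) (cdf_continuous h.int).continuousOn ?_
  rw [h.cdf_a, h.cdf_neg_a]
  exact ⟨mul_pos ht.1 hI, by nlinarith [ht.2]⟩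

theorem idFun_mem (h : IsProfile F a) {t : ℝ} (ht : t ∈ Ioo (0 : ℝ) 1) :
    idFun F t ∈ Ioo (-a) a := by
  obtain ⟨s, hs, hst⟩ := h.exists_cdf_eq ht
  rwa [h.idFun_eq hs hst]

theorem cdf_idFun (h : IsProfile F a) {t : ℝ} (ht : t ∈ Ioo (0 : ℝ) 1) :
    cdf F (idFun F t) = t * ∫ x, F x := by
  obtain ⟨s, hs, hst⟩ := h.exists_cdf_eq ht
  rwa [h.idFun_eq hs hst]

theorem idFun_one_sub (h : IsProfile F a) {t : ℝ} (ht : t ∈ Ioo (0 : ℝ) 1) :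
    idFun F (1 - t) = -idFun F t := by
  have hm := h.idFun_mem ht
  refine h.idFun_eq ⟨by linarith [hm.2], by linarith [hm.1]⟩ ?_
  rw [h.cdf_neg, h.cdf_idFun ht]; ring

theorem idFun_half (h : IsProfile F a) : idFun F (1 / 2) = 0 := by
  have := h.idFun_one_sub (t := 1 / 2) (by norm_num)
  rw [show (1 : ℝ) - 1 / 2 = 1 / 2 by norm_num] at this
  linarith

theorem idFun_strictMonoOn (h : IsProfile F a) : StrictMonoOn (idFun F) (Ioo 0 1) := by
  intro t ht t' ht' hlt
  refine h.cdf_mono.reflect_lt ?_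
  rw [h.cdf_idFun ht, h.cdf_idFun ht']
  exact mul_lt_mul_of_pos_right hlt h.integral_pos

theorem image_idFun (h : IsProfile F a) : idFun F '' Ioo 0 1 = Ioo (-a) a := by
  ext s
  constructor
  · rintro ⟨t, ht, rfl⟩; exact h.idFun_mem ht
  · intro hs
    have hI := h.integral_pos
    have h1 : 0 < cdf F s := by
      rw [← h.cdf_neg_a]; exact h.cdf_lt le_rfl (by linarith [h.a_pos]) hs.1
    have h2 : cdf F s < ∫ x, F x := by
      rw [← h.cdf_a]; exact h.cdf_lt hs.1.le hs.2 hs.2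
    exact ⟨cdf F s / ∫ x, F x, ⟨div_pos h1 hI, (div_lt_one hI).2 h2⟩,
      h.idFun_eq hs (by field_simp)⟩

/-- A monotone function whose image is an interval cannot jump. -/
theorem continuousAt_idFun (h : IsProfile F a) {t : ℝ} (ht : t ∈ Ioo (0 : ℝ) 1) :
    ContinuousAt (idFun F) t := by
  refine continuousAt_of_monotoneOn_of_image_mem_nhds h.idFun_strictMonoOn.monotoneOn
    (Ioo_mem_nhds ht.1 ht.2) ?_
  rw [h.image_idFun]
  exact Ioo_mem_nhds (h.idFun_mem ht).1 (h.idFun_mem ht).2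

theorem hasDerivAt_cdf (h : IsProfile F a) {s : ℝ} (hs : s ∈ Ioo (-a) a) :
    HasDerivAt (cdf F) (F s) s := by
  have : cdf F = fun s => cdf F 0 + ∫ x in (0 : ℝ)..s, F x := by
    funext s; rw [← cdf_sub h.int]; ring
  rw [this]
  have hc : ContinuousAt F s := h.cont.continuousAt (Ioo_mem_nhds hs.1 hs.2)
  exact (intervalIntegral.integral_hasDerivAt_right h.int.intervalIntegrable
    (h.int.aestronglyMeasurable.stronglyMeasurableAtFilter) hc).const_add _

theorem hasDerivAt_idFun (h : IsProfile F a) {t : ℝ} (ht : t ∈ Ioo (0 : ℝ) 1) :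
    HasDerivAt (idFun F) ((∫ x, F x) / F (idFun F t)) t := by
  have hI := h.integral_pos
  have hm := h.idFun_mem ht
  have h1 := (h.hasDerivAt_cdf hm).div_const (∫ x, F x)
  have h2 := h1.of_local_left_inverse (g := idFun F) (h.continuousAt_idFun ht)
    (div_pos (h.pos _ hm) hI).ne' (by
      filter_upwards [Ioo_mem_nhds ht.1 ht.2] with t' ht'
      rw [h.cdf_idFun ht']; field_simp)
  rwa [inv_div] at h2

theorem deriv_idFun (h : IsProfile F a) {t : ℝ} (ht : t ∈ Ioo (0 : ℝ) 1) :
    deriv (idFun F) t = (∫ x, F x) / F (idFun F t) := (h.hasDerivAt_idFun ht).deriv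

theorem deriv_idFun_pos (h : IsProfile F a) {t : ℝ} (ht : t ∈ Ioo (0 : ℝ) 1) :
    0 < deriv (idFun F) t := by
  rw [h.deriv_idFun ht]
  exact div_pos h.integral_pos (h.pos _ (h.idFun_mem ht))

theorem continuousOn_deriv_idFun (h : IsProfile F a) :
    ContinuousOn (deriv (idFun F)) (Ioo 0 1) := by
  have : ContinuousOn (fun t => (∫ x, F x) / F (idFun F t)) (Ioo 0 1) := by
    refine continuousOn_const.div ?_ fun t ht => (h.pos _ (h.idFun_mem ht)).ne'
    exact h.cont.comp (fun t ht => (h.continuousAt_idFun ht).continuousWithinAt)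
      fun t ht => h.idFun_mem ht
  exact this.congr fun t ht => h.deriv_idFun ht

theorem deriv_idFun_one_sub (h : IsProfile F a) {t : ℝ} (ht : t ∈ Ioo (0 : ℝ) 1) :
    deriv (idFun F) (1 - t) = deriv (idFun F) t := by
  rw [h.deriv_idFun ht, h.deriv_idFun ⟨by linarith [ht.2], by linarith [ht.1]⟩,
    h.idFun_one_sub ht, h.even]

end IsProfile

/-! ### The geometric primitive in one variable -/

theorem half_mem_Ioo : (1 / 2 : ℝ) ∈ Ioo (0 : ℝ) 1 := by norm_num

theorem uIcc_half_subset {t : ℝ} (ht : t ∈ Ioo (0 : ℝ) 1) : uIcc (1 / 2) t ⊆ Ioo (0 : ℝ) 1 :=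
  ordConnected_Ioo.uIcc_subset half_mem_Ioo ht

section Primitive

variable {F G : ℝ → ℝ} {a b : ℝ} (hF : IsProfile F a) (hG : IsProfile G b) (lam : ℝ)

/-- The integrand of the standard geometric primitive of two inverse distribution functions. -/
def geomDeriv (F G : ℝ → ℝ) (lam s : ℝ) : ℝ :=
  deriv (idFun F) s ^ (1 - lam) * deriv (idFun G) s ^ lam

include hF hG in
theorem geomDeriv_pos {t : ℝ} (ht : t ∈ Ioo (0 : ℝ) 1) : 0 < geomDeriv F G lam t :=
  mul_pos (Real.rpow_pos_of_pos (hF.deriv_idFun_pos ht) _)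
    (Real.rpow_pos_of_pos (hG.deriv_idFun_pos ht) _)

include hF hG in
theorem geomDeriv_continuousOn : ContinuousOn (geomDeriv F G lam) (Ioo 0 1) :=
  (hF.continuousOn_deriv_idFun.rpow_const fun _ ht => Or.inl (hF.deriv_idFun_pos ht).ne').mul
    (hG.continuousOn_deriv_idFun.rpow_const fun _ ht => Or.inl (hG.deriv_idFun_pos ht).ne')

include hF hG in
theorem hasDerivAt_stdPrimitive {t : ℝ} (ht : t ∈ Ioo (0 : ℝ) 1) :
    HasDerivAt (stdPrimitive lam (idFun F) (idFun G)) (geomDeriv F G lam t) t := by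
  have hc := geomDeriv_continuousOn hF hG lam
  refine intervalIntegral.integral_hasDerivAt_right
    (hc.mono (uIcc_half_subset ht)).intervalIntegrable ?_
    (hc.continuousAt (Ioo_mem_nhds ht.1 ht.2))
  exact hc.stronglyMeasurableAtFilter isOpen_Ioo t ht

include hF hG in
theorem stdPrimitive_strictMonoOn :
    StrictMonoOn (stdPrimitive lam (idFun F) (idFun G)) (Ioo 0 1) := by
  refine strictMonoOn_of_deriv_pos (convex_Ioo 0 1)
    (fun t ht => (hasDerivAt_stdPrimitive hF hG lam ht).continuousAt.continuousWithinAt) ?_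
  intro t ht
  rw [interior_Ioo] at ht
  rw [(hasDerivAt_stdPrimitive hF hG lam ht).deriv]
  exact geomDeriv_pos hF hG lam ht

include hF hG in
theorem stdPrimitive_one_sub {t : ℝ} (ht : t ∈ Ioo (0 : ℝ) 1) :
    stdPrimitive lam (idFun F) (idFun G) (1 - t) = -stdPrimitive lam (idFun F) (idFun G) t := by
  have h1 : stdPrimitive lam (idFun F) (idFun G) t =
      ∫ s in (1 / 2 : ℝ)..t, geomDeriv F G lam (1 - s) := by
    refine intervalIntegral.integral_congr fun s hs => ?_
    have hs' := uIcc_half_subset ht hs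
    simp only [geomDeriv]
    rw [hF.deriv_idFun_one_sub hs', hG.deriv_idFun_one_sub hs']
  rw [h1, intervalIntegral.integral_comp_sub_left, ← intervalIntegral.integral_symm]
  norm_num [stdPrimitive, geomDeriv]

-- Hölder's inequality for the two derivatives, whose integrals from `1/2` are the values of the
-- inverse distribution functions.
include hF hG in
theorem stdPrimitive_le_of_half_lt (hlam : lam ∈ Icc (0 : ℝ) 1) {t : ℝ} (ht : t ∈ Ioo (0 : ℝ) 1)
    (h2 : 1 / 2 < t) :
    |stdPrimitive lam (idFun F) (idFun G) t| ≤ |idFun F t| ^ (1 - lam) * |idFun G t| ^ lam := by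
  have hA : 0 < idFun F t := by
    rw [← hF.idFun_half]; exact hF.idFun_strictMonoOn half_mem_Ioo ht h2
  have hB : 0 < idFun G t := by
    rw [← hG.idFun_half]; exact hG.idFun_strictMonoOn half_mem_Ioo ht h2
  have hsub := uIcc_half_subset ht
  have hw : 0 ≤ stdPrimitive lam (idFun F) (idFun G) t :=
    intervalIntegral.integral_nonneg h2.le fun s hs =>
      (geomDeriv_pos hF hG lam (hsub (by rwa [uIcc_of_le h2.le]))).le
  rw [abs_of_nonneg hw, abs_of_pos hA, abs_of_pos hB]
  set A := idFun F t
  set B := idFun G t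
  set C := A ^ (1 - lam) * B ^ lam with hC
  have hCpos : 0 < C := mul_pos (Real.rpow_pos_of_pos hA _) (Real.rpow_pos_of_pos hB _)
  have iF : IntervalIntegrable (deriv (idFun F)) volume (1 / 2) t :=
    (hF.continuousOn_deriv_idFun.mono hsub).intervalIntegrable
  have iG : IntervalIntegrable (deriv (idFun G)) volume (1 / 2) t :=
    (hG.continuousOn_deriv_idFun.mono hsub).intervalIntegrable
  have eF : ∫ s in (1 / 2 : ℝ)..t, deriv (idFun F) s = A := by
    rw [intervalIntegral.integral_deriv_eq_sub
      (fun s hs => (hF.hasDerivAt_idFun (hsub hs)).differentiableAt) iF, hF.idFun_half, sub_zero]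
  have eG : ∫ s in (1 / 2 : ℝ)..t, deriv (idFun G) s = B := by
    rw [intervalIntegral.integral_deriv_eq_sub
      (fun s hs => (hG.hasDerivAt_idFun (hsub hs)).differentiableAt) iG, hG.idFun_half, sub_zero]
  -- Weighted AM-GM for `u'/A` and `v'/B`, multiplied by `C`; the majorant integrates to `C * (1 -
  -- lam) + C * lam = C`.
  have hle : stdPrimitive lam (idFun F) (idFun G) t ≤ ∫ s in (1 / 2 : ℝ)..t,
      (C * (1 - lam) / A * deriv (idFun F) s + C * lam / B * deriv (idFun G) s) := by
    refine intervalIntegral.integral_mono_on h2.le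
      ((geomDeriv_continuousOn hF hG lam).mono hsub).intervalIntegrable
      ((iF.const_mul _).add (iG.const_mul _)) fun s hs => ?_
    have hs' : s ∈ Ioo (0 : ℝ) 1 := hsub (by rwa [uIcc_of_le h2.le])
    have pF := hF.deriv_idFun_pos hs'
    have pG := hG.deriv_idFun_pos hs'
    have amgm := Real.geom_mean_le_arith_mean2_weighted (sub_nonneg.2 hlam.2) hlam.1
      (div_pos pF hA).le (div_pos pG hB).le (by ring)
    rw [Real.div_rpow pF.le hA.le, Real.div_rpow pG.le hB.le, div_mul_div_comm, ← hC,
      div_le_iff₀ hCpos] at amgm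
    refine amgm.trans (le_of_eq ?_)
    ring
  rw [intervalIntegral.integral_add (iF.const_mul _) (iG.const_mul _),
    intervalIntegral.integral_const_mul, intervalIntegral.integral_const_mul, eF, eG] at hle
  refine hle.trans (le_of_eq ?_)
  field_simp
  ring

include hF hG in
theorem abs_stdPrimitive_le (hlam : lam ∈ Icc (0 : ℝ) 1) {t : ℝ} (ht : t ∈ Ioo (0 : ℝ) 1) :
    |stdPrimitive lam (idFun F) (idFun G) t| ≤ |idFun F t| ^ (1 - lam) * |idFun G t| ^ lam := by
  rcases lt_trichotomy t (1 / 2) with h | h | h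
  · have := stdPrimitive_le_of_half_lt hF hG lam hlam (t := 1 - t)
      ⟨by linarith [ht.2], by linarith [ht.1]⟩ (by linarith)
    rwa [stdPrimitive_one_sub hF hG lam ht, hF.idFun_one_sub ht, hG.idFun_one_sub ht, abs_neg,
      abs_neg, abs_neg] at this
  · subst h
    simp only [stdPrimitive, intervalIntegral.integral_same, abs_zero]
    positivity
  · exact stdPrimitive_le_of_half_lt hF hG lam hlam ht h

end Primitive

/-! ### Unconditional bodies and their sections -/

/-- An unconditional compact convex set with the origin in its interior. -/
structure IsUncondBody {n : ℕ} (K : Set (Fin n → ℝ)) : Prop where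
  convex : Convex ℝ K
  compact : IsCompact K
  uncond : Unconditional K
  pos : ∃ r > 0, (fun _ => r) ∈ K

/-- The new point lies on the segment joining `x` to its reflection in the `i`-th hyperplane. -/
theorem Unconditional.update_mem {n : ℕ} {K : Set (Fin n → ℝ)} (hK : Unconditional K)
    (hc : Convex ℝ K) {x : Fin n → ℝ} (hx : x ∈ K) (i : Fin n) {c : ℝ} (h : |c| ≤ |x i|) :
    Function.update x i c ∈ K := by
  rcases eq_or_ne (x i) 0 with h0 | h0
  · have : c = 0 := by simpa [h0] using h
    rw [this, ← h0, Function.update_eq_self]; exact hx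
  · have hr : |c / x i| ≤ 1 := by rw [abs_div]; exact (div_le_one (abs_pos.2 h0)).2 h
    rw [abs_le] at hr
    have := hc hx (hK x hx i) (a := (1 + c / x i) / 2) (b := (1 - c / x i) / 2)
      (by linarith) (by linarith) (by ring)
    convert this using 1
    ext j
    rcases eq_or_ne j i with rfl | hj
    · simp
      field_simp
      ring
    · simp [hj]
      ring

theorem Unconditional.solid {n : ℕ} {K : Set (Fin n → ℝ)} (hK : Unconditional K)
    (hc : Convex ℝ K) {x y : Fin n → ℝ} (hx : x ∈ K) (h : ∀ i, |y i| ≤ |x i|) : y ∈ K := by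
  -- Coordinates are replaced one at a time, `s` being the set already replaced.
  classical
  have key : ∀ s : Finset (Fin n), (fun i => if i ∈ s then y i else x i) ∈ K := by
    intro s
    induction s using Finset.induction_on with
    | empty => simpa using hx
    | insert i s hi ih =>
      have := hK.update_mem hc ih i (c := y i) (by simpa [hi] using h i)
      convert this using 1
      ext j
      rcases eq_or_ne j i with rfl | hj
      · simp
      · simp [hj]
  simpa using key Finset.univ

theorem isUncondBody_of_convexBody {n : ℕ} (K : ConvexBody (Fin n → ℝ))
    (hint : (interior (K : Set (Fin n → ℝ))).Nonempty)
    (hK : Unconditional (K : Set (Fin n → ℝ))) : IsUncondBody (K : Set (Fin n → ℝ)) where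
  convex := K.convex
  compact := K.isCompact
  uncond := hK
  pos := by
    obtain ⟨x, hx⟩ := hint
    obtain ⟨r, hr, hball⟩ := Metric.mem_nhds_iff.1 (mem_interior_iff_mem_nhds.1 hx)
    refine ⟨r / 2, by positivity, ?_⟩
    -- Moving each coordinate of an interior point away from zero by `r / 2` stays in the ball and
    -- makes every coordinate at least `r / 2` in absolute value.
    have hmem : (fun i => x i + (if 0 ≤ x i then r / 2 else -(r / 2))) ∈
        (K : Set (Fin n → ℝ)) := by
      apply hball
      rw [Metric.mem_ball, dist_pi_lt_iff hr]
      intro i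
      rw [Real.dist_eq, add_sub_cancel_left]
      split_ifs
      · rw [abs_of_pos (by positivity)]; linarith
      · rw [abs_neg, abs_of_pos (by positivity)]; linarith
    refine hK.solid K.convex hmem fun i => ?_
    rw [abs_of_pos (by positivity : (0 : ℝ) < r / 2)]
    split_ifs with h
    · exact le_trans (by linarith) (le_abs_self _)
    · exact le_trans (by linarith) (neg_le_abs _)

/-- The section of `K` at `x₁ = s`. -/
def sec {n : ℕ} (K : Set (Fin (n + 1) → ℝ)) (s : ℝ) : Set (Fin n → ℝ) :=
  {y | (Fin.cons s y : Fin (n + 1) → ℝ) ∈ K}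

/-- The half-width of `K` in the direction of the first axis. -/
def width {n : ℕ} (K : Set (Fin (n + 1) → ℝ)) : ℝ :=
  sSup {s : ℝ | (Fin.cons s 0 : Fin (n + 1) → ℝ) ∈ K}

/-- The volume of the section of `K` at `x₁ = s`. -/
def secVol {n : ℕ} (K : Set (Fin (n + 1) → ℝ)) (s : ℝ) : ℝ :=
  ∫ y : Fin n → ℝ, charFn K (Fin.cons s y)

theorem continuous_cons {n : ℕ} :
    Continuous fun p : ℝ × (Fin n → ℝ) => (Fin.cons p.1 p.2 : Fin (n + 1) → ℝ) := by
  refine continuous_pi fun i => ?_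
  refine Fin.cases ?_ (fun j => ?_) i
  · simpa using continuous_fst
  · simp only [Fin.cons_succ]; fun_prop

theorem piFinSuccAbove_symm_apply {n : ℕ} (p : ℝ × (Fin n → ℝ)) :
    (MeasurableEquiv.piFinSuccAbove (fun _ : Fin (n + 1) => ℝ) 0).symm p = Fin.cons p.1 p.2 := by
  ext i
  refine Fin.cases ?_ (fun j => ?_) i <;> simp [MeasurableEquiv.piFinSuccAbove]

theorem volume_eq_lintegral {n : ℕ} {A : Set (Fin (n + 1) → ℝ)} (hA : MeasurableSet A) :
    volume A = ∫⁻ s, volume (sec A s) := by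
  have hmp := (MeasureTheory.volume_preserving_piFinSuccAbove (fun _ : Fin (n + 1) => ℝ) 0).symm
  rw [← hmp.measure_preimage_equiv A]
  refine (Measure.prod_apply ((MeasurableEquiv.measurable _) hA)).trans ?_
  refine lintegral_congr fun s => ?_
  congr 1
  ext y
  simp only [mem_preimage, piFinSuccAbove_symm_apply]
  rfl

theorem cons_combo {n : ℕ} (p q s s' : ℝ) (y y' : Fin n → ℝ) :
    p • (Fin.cons s y : Fin (n + 1) → ℝ) + q • (Fin.cons s' y' : Fin (n + 1) → ℝ) =
      Fin.cons (p * s + q * s') (p • y + q • y') := by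
  ext i
  refine Fin.cases ?_ (fun j => ?_) i <;> simp

theorem charFn_cons {n : ℕ} (K : Set (Fin (n + 1) → ℝ)) (s : ℝ) :
    (fun y => charFn K (Fin.cons s y)) = charFn (sec K s) := rfl

namespace IsUncondBody

variable {n : ℕ}

theorem solid {K : Set (Fin n → ℝ)} (h : IsUncondBody K) {x y : Fin n → ℝ}
    (hx : x ∈ K) (hxy : ∀ i, |y i| ≤ |x i|) : y ∈ K := h.uncond.solid h.convex hx hxy

theorem measurableSet {K : Set (Fin n → ℝ)} (h : IsUncondBody K) : MeasurableSet K :=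
  h.compact.isClosed.measurableSet

theorem volume_pos {K : Set (Fin n → ℝ)} (h : IsUncondBody K) : 0 < volume K := by
  obtain ⟨r, hr, hmem⟩ := h.pos
  have : Metric.ball (0 : Fin n → ℝ) r ⊆ K := by
    intro y hy
    refine h.solid hmem fun i => ?_
    rw [abs_of_pos hr]
    rw [Metric.mem_ball, dist_pi_lt_iff hr] at hy
    simpa [Real.dist_eq] using (hy i).le
  exact (Metric.measure_ball_pos volume _ hr).trans_le (measure_mono this)

theorem volume_ne_top {K : Set (Fin n → ℝ)} (h : IsUncondBody K) : volume K ≠ ⊤ :=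
  h.compact.measure_lt_top.ne

variable {K : Set (Fin (n + 1) → ℝ)}

theorem cons_solid (h : IsUncondBody K) {s s' : ℝ} {y y' : Fin n → ℝ}
    (hx : (Fin.cons s y : Fin (n + 1) → ℝ) ∈ K) (hs : |s'| ≤ |s|) (hy : ∀ i, |y' i| ≤ |y i|) :
    (Fin.cons s' y' : Fin (n + 1) → ℝ) ∈ K :=
  h.solid hx fun i => by refine Fin.cases ?_ (fun j => ?_) i <;> simp [hs, hy]

theorem axis_compact (h : IsUncondBody K) :
    IsCompact {s : ℝ | (Fin.cons s 0 : Fin (n + 1) → ℝ) ∈ K} := by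
  refine (h.compact.image (continuous_apply 0)).of_isClosed_subset
    (h.compact.isClosed.preimage (continuous_cons.comp (continuous_id.prodMk continuous_const)))
    fun s hs => ⟨_, hs, by simp⟩

theorem axis_mem (h : IsUncondBody K) : (Fin.cons (width K) 0 : Fin (n + 1) → ℝ) ∈ K := by
  refine h.axis_compact.sSup_mem ?_
  obtain ⟨r, hr, hmem⟩ := h.pos
  refine ⟨r, h.solid hmem fun i => ?_⟩
  refine Fin.cases ?_ (fun j => ?_) i <;> simp

theorem abs_le_width (h : IsUncondBody K) {s : ℝ} {y : Fin n → ℝ}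
    (hx : (Fin.cons s y : Fin (n + 1) → ℝ) ∈ K) : |s| ≤ width K :=
  le_csSup h.axis_compact.bddAbove (h.cons_solid hx (by simp) (by simp))

theorem width_pos (h : IsUncondBody K) : 0 < width K := by
  obtain ⟨r, hr, hmem⟩ := h.pos
  have : (fun _ => r : Fin (n + 1) → ℝ) = Fin.cons r (fun _ => r) := by
    ext i; refine Fin.cases ?_ (fun j => ?_) i <;> simp
  rw [this] at hmem
  have := h.abs_le_width hmem
  rw [abs_of_pos hr] at this
  linarith

theorem sec_compact (h : IsUncondBody K) (s : ℝ) : IsCompact (sec K s) := by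
  refine (h.compact.image (f := Fin.tail) (continuous_pi fun j => continuous_apply _)
    ).of_isClosed_subset
    (h.compact.isClosed.preimage (continuous_cons.comp (continuous_const.prodMk continuous_id)))
    fun y hy => ⟨_, hy, by simp⟩

theorem sec_isUncondBody (h : IsUncondBody K) {s : ℝ} (hs : s ∈ Ioo (-width K) (width K)) :
    IsUncondBody (sec K s) where
  convex := by
    intro y hy y' hy' p q hp hq hpq
    have := h.convex hy hy' hp hq hpq
    rw [cons_combo, ← add_mul, hpq, one_mul] at this
    exact this
  compact := h.sec_compact s
  uncond := by
    intro y hy i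
    refine h.cons_solid hy le_rfl fun j => ?_
    rcases eq_or_ne j i with rfl | hj
    · simp
    · simp [hj]
  pos := by
    obtain ⟨r, hr, hmem⟩ := h.pos
    have e : (fun _ => r : Fin (n + 1) → ℝ) = Fin.cons r (fun _ => r) := by
      ext i; refine Fin.cases ?_ (fun j => ?_) i <;> simp
    rw [e] at hmem
    have hw := h.width_pos
    have habs : |s| < width K := abs_lt.2 hs
    have hθ : |s| / width K < 1 := (div_lt_one hw).2 habs
    have hθ0 : 0 ≤ |s| / width K := by positivity
    have hθ1 : 0 < 1 - |s| / width K := sub_pos.2 hθ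
    refine ⟨(1 - |s| / width K) * r, mul_pos hθ1 hr, ?_⟩
    -- Combining the diagonal point with the tip of the axis, with weight `|s| / width K` on the
    -- tip, gives first coordinate at least `|s|` and leaves the other coordinates positive.
    have := h.convex hmem h.axis_mem (sub_nonneg.2 hθ.le) hθ0 (by ring)
    rw [cons_combo] at this
    refine h.cons_solid this ?_ fun i => by simp
    rw [div_mul_cancel₀ _ hw.ne']
    exact le_trans (by nlinarith [mul_pos hθ1 hr]) (le_abs_self _)

theorem secVol_eq (h : IsUncondBody K) (s : ℝ) : secVol K s = volume.real (sec K s) := by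
  unfold secVol
  rw [charFn_cons]
  exact integral_indicator_one (h.sec_compact s).isClosed.measurableSet

theorem ofReal_secVol (h : IsUncondBody K) (s : ℝ) :
    ENNReal.ofReal (secVol K s) = volume (sec K s) := by
  rw [h.secVol_eq]
  exact ENNReal.ofReal_toReal (h.sec_compact s).measure_lt_top.ne

theorem sec_eq_of_abs (h : IsUncondBody K) {s s' : ℝ} (hs : |s| = |s'|) : sec K s = sec K s' := by
  ext y
  exact ⟨fun hy => h.cons_solid hy hs.ge fun _ => le_rfl,
    fun hy => h.cons_solid hy hs.le fun _ => le_rfl⟩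

/-- `K` contains the cone over the section at `|s|` with apex at the tip of the axis. The resulting
comparison of section volumes yields their continuity without Brunn–Minkowski. -/
theorem smul_sec_subset (h : IsUncondBody K) {s s' : ℝ} (hs : |s| < width K)
    (hs' : |s'| < width K) :
    (min 1 ((width K - |s'|) / (width K - |s|))) • sec K s ⊆ sec K s' := by
  rintro _ ⟨y, hy, rfl⟩
  set c := min 1 ((width K - |s'|) / (width K - |s|)) with hc
  have hd : 0 < width K - |s| := sub_pos.2 hs
  have hc1 : c ≤ 1 := min_le_left _ _
  have hc0 : 0 ≤ c := le_min zero_le_one (div_nonneg (sub_pos.2 hs').le hd.le)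
  have hy' : (Fin.cons |s| y : Fin (n + 1) → ℝ) ∈ K := h.cons_solid hy (by simp) fun _ => le_rfl
  have := h.convex hy' h.axis_mem hc0 (sub_nonneg.2 hc1) (by ring)
  rw [cons_combo] at this
  refine h.cons_solid this ?_ fun i => by simp
  refine le_trans ?_ (le_abs_self _)
  have h2 : c * (width K - |s|) ≤ width K - |s'| :=
    (le_div_iff₀ hd).1 (min_le_right _ _)
  linarith

theorem secVol_le (h : IsUncondBody K) {s s' : ℝ} (hs : |s| < width K) (hs' : |s'| < width K) :
    (min 1 ((width K - |s'|) / (width K - |s|))) ^ n * secVol K s ≤ secVol K s' := by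
  have hc0 : 0 ≤ min 1 ((width K - |s'|) / (width K - |s|)) :=
    le_min zero_le_one (div_nonneg (sub_pos.2 hs').le (sub_pos.2 hs).le)
  have := measureReal_mono (μ := volume) (h.smul_sec_subset hs hs')
    (h.sec_compact s').measure_lt_top.ne
  rw [Measure.real, Measure.addHaar_smul, ENNReal.toReal_mul, ENNReal.toReal_ofReal (abs_nonneg _),
    Module.finrank_fin_fun, abs_of_nonneg (pow_nonneg hc0 _)] at this
  rwa [h.secVol_eq, h.secVol_eq]

theorem isProfile (h : IsUncondBody K) : IsProfile (secVol K) (width K) where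
  a_pos := h.width_pos
  even s := by rw [h.secVol_eq, h.secVol_eq, h.sec_eq_of_abs (abs_neg s)]
  nonneg s := by rw [h.secVol_eq]; exact measureReal_nonneg
  pos s hs := by
    rw [h.secVol_eq]
    have hb := h.sec_isUncondBody hs
    exact ENNReal.toReal_pos hb.volume_pos.ne' hb.volume_ne_top
  zero s hs := by
    have : sec K s = ∅ := by
      ext y
      simp only [mem_empty_iff_false, iff_false]
      exact fun hy => absurd (h.abs_le_width hy) (not_le.2 hs)
    rw [h.secVol_eq, this, measureReal_empty]
  -- Squeeze: `secVol_le` from `s` to `s'` bounds below, from `s'` to `s` above, and both factors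
  -- tend to 1.
  cont := by
    intro s hs
    have hsa : |s| < width K := abs_lt.2 hs
    have hd : width K - |s| ≠ 0 := (sub_pos.2 hsa).ne'
    have lower : Tendsto (fun s' => (min 1 ((width K - |s'|) / (width K - |s|))) ^ n * secVol K s)
        (𝓝[Ioo (-width K) (width K)] s) (𝓝 (secVol K s)) := by
      have : ContinuousAt
          (fun s' => (min 1 ((width K - |s'|) / (width K - |s|))) ^ n * secVol K s) s := by
        fun_prop
      have h2 := this.tendsto.mono_left (nhdsWithin_le_nhds (s := Ioo (-width K) (width K)))
      simpa [div_self hd] using h2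
    have upper : Tendsto (fun s' => secVol K s / (min 1 ((width K - |s|) / (width K - |s'|))) ^ n)
        (𝓝[Ioo (-width K) (width K)] s) (𝓝 (secVol K s)) := by
      have : ContinuousAt
          (fun s' => secVol K s / (min 1 ((width K - |s|) / (width K - |s'|))) ^ n) s := by
        have h1 : ContinuousAt (fun s' => min 1 ((width K - |s|) / (width K - |s'|))) s := by
          refine continuousAt_const.min (ContinuousAt.div (by fun_prop) (by fun_prop) hd)
        exact continuousAt_const.div (h1.pow n) (by simp [div_self hd])
      have h2 := this.tendsto.mono_left (nhdsWithin_le_nhds (s := Ioo (-width K) (width K)))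
      simpa [div_self hd] using h2
    refine tendsto_of_tendsto_of_tendsto_of_le_of_le' lower upper ?_ ?_
    · filter_upwards [self_mem_nhdsWithin] with s' hs'
      exact h.secVol_le hsa (abs_lt.2 hs')
    · filter_upwards [self_mem_nhdsWithin] with s' hs'
      have hsa' : |s'| < width K := abs_lt.2 hs'
      have hm : 0 < min 1 ((width K - |s|) / (width K - |s'|)) :=
        lt_min one_pos (div_pos (sub_pos.2 hsa) (sub_pos.2 hsa'))
      rw [le_div_iff₀ (pow_pos hm n), mul_comm]
      exact h.secVol_le hsa' hsa
  int := by
    have hmp := (MeasureTheory.volume_preserving_piFinSuccAbove (fun _ : Fin (n + 1) => ℝ) 0).symm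
    have hK : Integrable (charFn K) :=
      (integrable_indicator_iff h.measurableSet).2 (integrableOn_const h.volume_ne_top)
    have := (hmp.integrable_comp_emb (MeasurableEquiv.measurableEmbedding _)).2 hK
    refine (Integrable.integral_prod_left this).congr (Eventually.of_forall fun s => ?_)
    simp only [Function.comp, piFinSuccAbove_symm_apply, secVol]

theorem ofReal_integral_secVol (h : IsUncondBody K) :
    ENNReal.ofReal (∫ s, secVol K s) = volume K := by
  rw [ofReal_integral_eq_lintegral_ofReal h.isProfile.int
    (Eventually.of_forall h.isProfile.nonneg), volume_eq_lintegral h.measurableSet]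
  simp_rw [h.ofReal_secVol]

end IsUncondBody

/-! ### Slicing the combination; unconditionality and the product body -/

section Fields

/-- The first component of the inverse distribution field of a body. -/
def firstId {n : ℕ} (K : Set (Fin (n + 1) → ℝ)) : ℝ → ℝ := idFun (secVol K)

/-- The first component of the standard geometric potential of two bodies. -/
def firstPot {n : ℕ} (lam : ℝ) (K L : Set (Fin (n + 1) → ℝ)) : ℝ → ℝ :=
  stdPrimitive lam (firstId K) (firstId L)

/-- The standard geometric potential of two bodies. -/
def bodyPot {n : ℕ} (lam : ℝ) (K L : Set (Fin n → ℝ)) : (Fin n → ℝ) → (Fin n → ℝ) :=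
  stdPotential lam (idField (charFn K)) (idField (charFn L))

variable {n : ℕ}

theorem idField_charFn (K : Set (Fin (n + 1) → ℝ)) (t : Fin (n + 1) → ℝ) :
    idField (charFn K) t = Fin.cons (firstId K (t 0))
      (idField (charFn (sec K (firstId K (t 0)))) (Fin.tail t)) := rfl

/-- Varying a later coordinate leaves `t 0` fixed, so the later components only see the two sections
selected by `t 0`. -/
theorem bodyPot_succ (lam : ℝ) (K L : Set (Fin (n + 1) → ℝ)) (t : Fin (n + 1) → ℝ) :
    bodyPot lam K L t = Fin.cons (firstPot lam K L (t 0))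
      (bodyPot lam (sec K (firstId K (t 0))) (sec L (firstId L (t 0))) (Fin.tail t)) := by
  ext i
  refine Fin.cases ?_ (fun j => ?_) i
  · simp [bodyPot, stdPotential, idField_charFn, firstPot]
  · simp only [bodyPot, stdPotential, idField_charFn, Fin.cons_succ, Fin.tail_update_succ,
      Function.update_of_ne (Fin.succ_ne_zero j).symm]
    rfl

theorem cons_mem_unitCube {t₀ : ℝ} {t : Fin n → ℝ} :
    (Fin.cons t₀ t : Fin (n + 1) → ℝ) ∈ unitCube (n + 1) ↔ t₀ ∈ Ioo (0 : ℝ) 1 ∧ t ∈ unitCube n :=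
  by simp [unitCube, Fin.forall_fin_succ]

theorem IsUncondBody.sec_firstId {K : Set (Fin (n + 1) → ℝ)} (hK : IsUncondBody K) {t : ℝ}
    (ht : t ∈ Ioo (0 : ℝ) 1) : IsUncondBody (sec K (firstId K t)) :=
  hK.sec_isUncondBody (hK.isProfile.idFun_mem ht)

theorem IsUncondBody.idField_mem : ∀ {n : ℕ} {K : Set (Fin n → ℝ)} (_ : IsUncondBody K)
    {t : Fin n → ℝ} (_ : t ∈ unitCube n), idField (charFn K) t ∈ K
  | 0, K, hK, t, _ => by
    obtain ⟨r, -, hr⟩ := hK.pos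
    rwa [Subsingleton.elim (idField (charFn K) t) fun _ => r]
  | n + 1, K, hK, t, ht =>
    (hK.sec_firstId (ht 0)).idField_mem (t := Fin.tail t) fun i => ht i.succ

/-- Both fields stay inside their bodies on the cube, so both characteristic functions equal 1
there. -/
theorem setComb_eq_image {lam : ℝ} {K L : Set (Fin n → ℝ)} (hK : IsUncondBody K)
    (hL : IsUncondBody L) : setComb lam K L = bodyPot lam K L '' unitCube n := by
  ext x
  by_cases h : ∃ t ∈ unitCube n, stdPotential lam (idField (charFn K)) (idField (charFn L)) t = x
  · have h1 : charFn K (idField (charFn K) h.choose) = 1 :=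
      indicator_of_mem (hK.idField_mem h.choose_spec.1) _
    have h2 : charFn L (idField (charFn L) h.choose) = 1 :=
      indicator_of_mem (hL.idField_mem h.choose_spec.1) _
    have : geomComb lam (charFn K) (charFn L) x = 1 := by
      rw [geomComb, dif_pos h, h1, h2]; simp
    exact iff_of_true this h
  · have : geomComb lam (charFn K) (charFn L) x = 0 := by rw [geomComb, dif_neg h]
    exact iff_of_false (by simp [setComb, this]) h

theorem mem_setComb_succ {lam : ℝ} {K L : Set (Fin (n + 1) → ℝ)} (hK : IsUncondBody K)
    (hL : IsUncondBody L) {x : Fin (n + 1) → ℝ} :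
    x ∈ setComb lam K L ↔ ∃ t ∈ Ioo (0 : ℝ) 1, firstPot lam K L t = x 0 ∧
      Fin.tail x ∈ setComb lam (sec K (firstId K t)) (sec L (firstId L t)) := by
  rw [setComb_eq_image hK hL]
  constructor
  · rintro ⟨t, ht, rfl⟩
    refine ⟨t 0, ht 0, by simp [bodyPot_succ], ?_⟩
    rw [setComb_eq_image (hK.sec_firstId (ht 0)) (hL.sec_firstId (ht 0)), bodyPot_succ,
      Fin.tail_cons]
    exact ⟨Fin.tail t, fun i => ht i.succ, rfl⟩
  · rintro ⟨t₀, ht₀, h0, h⟩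
    rw [setComb_eq_image (hK.sec_firstId ht₀) (hL.sec_firstId ht₀)] at h
    obtain ⟨t, ht, hx⟩ := h
    refine ⟨Fin.cons t₀ t, cons_mem_unitCube.2 ⟨ht₀, ht⟩, ?_⟩
    rw [bodyPot_succ, Fin.cons_zero, Fin.tail_cons, h0, hx, Fin.cons_self_tail]

theorem unconditional_setComb (lam : ℝ) : ∀ {n : ℕ} {K L : Set (Fin n → ℝ)}
    (_ : IsUncondBody K) (_ : IsUncondBody L), Unconditional (setComb lam K L)
  | 0, K, L, _, _ => fun _ _ i => i.elim0
  | n + 1, K, L, hK, hL => by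
    intro x hx i
    rw [mem_setComb_succ hK hL] at hx ⊢
    obtain ⟨t, ht, h0, htail⟩ := hx
    refine Fin.cases ?_ (fun j => ?_) i
    -- Passing from `t` to `1 - t` negates both inverse distribution functions and the primitive,
    -- while the sections are unchanged.
    · refine ⟨1 - t, ⟨by linarith [ht.2], by linarith [ht.1]⟩, ?_, ?_⟩
      · rw [Function.update_self, ← h0]
        exact stdPrimitive_one_sub hK.isProfile hL.isProfile lam ht
      · rw [Fin.tail_update_zero, firstId, firstId, hK.isProfile.idFun_one_sub ht,
          hL.isProfile.idFun_one_sub ht, hK.sec_eq_of_abs (abs_neg _),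
          hL.sec_eq_of_abs (abs_neg _)]
        exact htail
    · refine ⟨t, ht, ?_, ?_⟩
      · rwa [Function.update_of_ne (Fin.succ_ne_zero j).symm]
      · rw [Fin.tail_update_succ]
        exact unconditional_setComb lam (hK.sec_firstId ht) (hL.sec_firstId ht) _ htail j

/-- Since the exponents sum to 1, shrinking `p` and `q` by a common factor shrinks the right side by
that factor. -/
theorem exists_scaling {lam : ℝ} {w p q : ℝ}
    (h : |w| ≤ |p| ^ (1 - lam) * |q| ^ lam) :
    ∃ p' q' : ℝ, |p'| ≤ |p| ∧ |q'| ≤ |q| ∧ |w| = |p'| ^ (1 - lam) * |q'| ^ lam := by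
  rcases eq_or_ne w 0 with rfl | hw
  · refine ⟨0, 0, by simp, by simp, ?_⟩
    -- The exponents are not both zero, so the convention `0 ^ 0 = 1` does no harm.
    rcases eq_or_ne lam 0 with rfl | h0
    · simp
    · simp [Real.zero_rpow h0]
  · have hw' : 0 < |w| := abs_pos.2 hw
    have hpos := hw'.trans_le h
    set c := |w| / (|p| ^ (1 - lam) * |q| ^ lam)
    have hc : 0 < c := div_pos hw' hpos
    have hc1 : c ≤ 1 := (div_le_one hpos).2 h
    refine ⟨c * p, c * q, ?_, ?_, ?_⟩
    · rw [abs_mul, abs_of_pos hc]; exact mul_le_of_le_one_left (abs_nonneg _) hc1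
    · rw [abs_mul, abs_of_pos hc]; exact mul_le_of_le_one_left (abs_nonneg _) hc1
    · rw [abs_mul, abs_mul, abs_of_pos hc, Real.mul_rpow hc.le (abs_nonneg _),
        Real.mul_rpow hc.le (abs_nonneg _), mul_mul_mul_comm, ← Real.rpow_add hc,
        sub_add_cancel, Real.rpow_one, div_mul_cancel₀ _ hpos.ne']

theorem setComb_subset_productBody {lam : ℝ} (hlam : lam ∈ Icc (0 : ℝ) 1) :
    ∀ {n : ℕ} {K L : Set (Fin n → ℝ)} (_ : IsUncondBody K) (_ : IsUncondBody L),
      setComb lam K L ⊆ productBody lam K L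
  | 0, K, L, hK, hL => by
    obtain ⟨r, -, hr⟩ := hK.pos
    obtain ⟨r', -, hr'⟩ := hL.pos
    exact fun z _ => ⟨_, hr, _, hr', fun i => i.elim0⟩
  | n + 1, K, L, hK, hL => by
    intro z hz
    obtain ⟨t, ht, h0, htail⟩ := (mem_setComb_succ hK hL).1 hz
    obtain ⟨x, hx, y, hy, hxy⟩ :=
      setComb_subset_productBody hlam (hK.sec_firstId ht) (hL.sec_firstId ht) htail
    obtain ⟨p, q, hp, hq, hpq⟩ :=
      exists_scaling (abs_stdPrimitive_le hK.isProfile hL.isProfile lam hlam ht)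
    refine ⟨Fin.cons p x, hK.cons_solid hx hp fun _ => le_rfl, Fin.cons q y,
      hL.cons_solid hy hq fun _ => le_rfl, fun i => ?_⟩
    refine Fin.cases ?_ (fun j => ?_) i
    · rw [← h0]; exact hpq
    · simpa [Fin.tail] using hxy j

/-! ### Hölder for sums and the 0-sum -/

theorem sum_rpow_mul_rpow_le {ι : Type*} (s : Finset ι) {f g : ι → ℝ} (hf : ∀ i, 0 ≤ f i)
    (hg : ∀ i, 0 ≤ g i) {lam : ℝ} (hlam : lam ∈ Icc (0 : ℝ) 1) :
    ∑ i ∈ s, f i ^ (1 - lam) * g i ^ lam ≤ (∑ i ∈ s, f i) ^ (1 - lam) * (∑ i ∈ s, g i) ^ lam := by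
  -- The endpoints are set apart because of `0 ^ 0 = 1`, and vanishing sums because the AM-GM
  -- argument divides by them.
  rcases eq_or_ne lam 0 with rfl | h0
  · simp
  rcases eq_or_ne lam 1 with rfl | h1
  · simp
  have h1' : 1 - lam ≠ 0 := sub_ne_zero.2 h1.symm
  rcases (Finset.sum_nonneg fun i _ => hf i : 0 ≤ ∑ i ∈ s, f i).eq_or_lt' with hA | hA
  · rw [Finset.sum_eq_zero, hA, Real.zero_rpow h1', zero_mul]
    intro i hi
    rw [(Finset.sum_eq_zero_iff_of_nonneg fun i _ => hf i).1 hA i hi, Real.zero_rpow h1', zero_mul]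
  rcases (Finset.sum_nonneg fun i _ => hg i : 0 ≤ ∑ i ∈ s, g i).eq_or_lt' with hB | hB
  · rw [Finset.sum_eq_zero, hB, Real.zero_rpow h0, mul_zero]
    intro i hi
    rw [(Finset.sum_eq_zero_iff_of_nonneg fun i _ => hg i).1 hB i hi, Real.zero_rpow h0, mul_zero]
  set A := ∑ i ∈ s, f i with hAdef
  set B := ∑ i ∈ s, g i with hBdef
  set C := A ^ (1 - lam) * B ^ lam with hC
  have hCpos : 0 < C := mul_pos (Real.rpow_pos_of_pos hA _) (Real.rpow_pos_of_pos hB _)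
  have key : ∀ i ∈ s, f i ^ (1 - lam) * g i ^ lam ≤
      C * (1 - lam) / A * f i + C * lam / B * g i := by
    intro i _
    have amgm := Real.geom_mean_le_arith_mean2_weighted (sub_nonneg.2 hlam.2) hlam.1
      (div_nonneg (hf i) hA.le) (div_nonneg (hg i) hB.le) (by ring)
    rw [Real.div_rpow (hf i) hA.le, Real.div_rpow (hg i) hB.le, div_mul_div_comm, ← hC,
      div_le_iff₀ hCpos] at amgm
    refine amgm.trans (le_of_eq ?_)
    ring
  refine (Finset.sum_le_sum key).trans (le_of_eq ?_)
  rw [Finset.sum_add_distrib, ← Finset.mul_sum, ← Finset.mul_sum, ← hAdef, ← hBdef]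
  field_simp
  ring

theorem IsUncondBody.sum_abs_le_supportFn {K : Set (Fin n → ℝ)} (hK : IsUncondBody K)
    {x : Fin n → ℝ} (hx : x ∈ K) (ξ : Fin n → ℝ) :
    ∑ i, |x i| * |ξ i| ≤ supportFn K ξ := by
  have hbdd : BddAbove ((fun x => x ⬝ᵥ ξ) '' K) :=
    (hK.compact.image (by unfold dotProduct; fun_prop)).bddAbove
  -- The signs of `x` are changed to match those of `ξ`, which unconditionality permits.
  refine le_csSup hbdd ⟨fun i => |x i| * SignType.sign (ξ i), hK.solid hx fun i => ?_, ?_⟩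
  · rw [abs_mul, abs_abs]
    refine mul_le_of_le_one_right (abs_nonneg _) ?_
    rcases lt_trichotomy (ξ i) 0 with h | h | h <;> simp [h]
  · refine Finset.sum_congr rfl fun i _ => ?_
    simp only
    rw [mul_assoc, sign_mul_self]

theorem productBody_subset_zeroSum {lam : ℝ} (hlam : lam ∈ Icc (0 : ℝ) 1)
    {K L : Set (Fin n → ℝ)} (hK : IsUncondBody K) (hL : IsUncondBody L) :
    productBody lam K L ⊆ zeroSum lam K L := by
  rintro z ⟨x, hx, y, hy, hz⟩ ξ -
  have h1 : z ⬝ᵥ ξ ≤ ∑ i, (|x i| * |ξ i|) ^ (1 - lam) * (|y i| * |ξ i|) ^ lam := by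
    refine Finset.sum_le_sum fun i _ => ?_
    refine (le_abs_self _).trans (le_of_eq ?_)
    have hξ : |ξ i| = |ξ i| ^ (1 - lam) * |ξ i| ^ lam := by
      rw [← Real.rpow_add_of_nonneg (abs_nonneg _) (sub_nonneg.2 hlam.2) hlam.1, sub_add_cancel,
        Real.rpow_one]
    rw [abs_mul, hz i, Real.mul_rpow (abs_nonneg _) (abs_nonneg _),
      Real.mul_rpow (abs_nonneg _) (abs_nonneg _), mul_mul_mul_comm, ← hξ]
  have hA : 0 ≤ ∑ i, |x i| * |ξ i| := Finset.sum_nonneg fun i _ => by positivity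
  have hB : 0 ≤ ∑ i, |y i| * |ξ i| := Finset.sum_nonneg fun i _ => by positivity
  refine h1.trans ((sum_rpow_mul_rpow_le _ (fun i => by positivity) (fun i => by positivity)
    hlam).trans ?_)
  have hA' := hK.sum_abs_le_supportFn hx ξ
  have hB' := hL.sum_abs_le_supportFn hy ξ
  exact mul_le_mul (Real.rpow_le_rpow hA hA' (sub_nonneg.2 hlam.2))
    (Real.rpow_le_rpow hB hB' hlam.1) (Real.rpow_nonneg hB _)
    (Real.rpow_nonneg (hA.trans hA') _)

end Fields

/-! ### Measurable dependence on parameters -/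

theorem measurable_sInf_of_isUpperSet {Q : Type*} [MeasurableSpace Q] {A : Q → Set ℝ}
    (hup : ∀ q, IsUpperSet (A q)) (hm : ∀ s, MeasurableSet {q | s ∈ A q}) :
    Measurable fun q => sInf (A q) := by
  have hin : MeasurableSet {q | ∃ r : ℚ, (r : ℝ) ∈ A q} := by
    simp only [ofPred_exists]; exact MeasurableSet.iUnion fun r => hm r
  have hout : MeasurableSet {q | ∃ r : ℚ, (r : ℝ) ∉ A q} := by
    simp only [ofPred_exists]; exact MeasurableSet.iUnion fun r => (hm r).compl
  have hlt : ∀ c : ℝ, MeasurableSet {q | ∃ r : ℚ, (r : ℝ) < c ∧ (r : ℝ) ∈ A q} := by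
    intro c
    simp only [ofPred_exists]
    exact MeasurableSet.iUnion fun r => (MeasurableSet.const _).inter (hm r)
  have ne_iff : ∀ q, (∃ r : ℚ, (r : ℝ) ∈ A q) ↔ (A q).Nonempty := fun q =>
    ⟨fun ⟨r, hr⟩ => ⟨r, hr⟩, fun ⟨s, hs⟩ =>
      let ⟨r, hr⟩ := exists_rat_gt s; ⟨r, hup q hr.le hs⟩⟩
  have bdd_iff : ∀ q, (∃ r : ℚ, (r : ℝ) ∉ A q) ↔ BddBelow (A q) := by
    intro q
    constructor
    · rintro ⟨r, hr⟩
      exact ⟨r, fun s hs => le_of_not_ge fun h => hr (hup q h hs)⟩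
    · rintro ⟨b, hb⟩
      obtain ⟨r, hr⟩ := exists_rat_lt b
      exact ⟨r, fun h => absurd (hb h) (not_le.2 hr)⟩
  refine measurable_of_Iio fun c => ?_
  -- For upper sets, `sInf < c` is witnessed by a rational. The last term covers empty or unbounded
  -- sets, where `sInf` is 0 by default.
  have : (fun q => sInf (A q)) ⁻¹' Iio c =
      ({q | ∃ r : ℚ, (r : ℝ) ∈ A q} ∩ {q | ∃ r : ℚ, (r : ℝ) ∉ A q} ∩
        {q | ∃ r : ℚ, (r : ℝ) < c ∧ (r : ℝ) ∈ A q}) ∪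
      (({q | ∃ r : ℚ, (r : ℝ) ∈ A q} ∩ {q | ∃ r : ℚ, (r : ℝ) ∉ A q})ᶜ ∩ {_q | 0 < c}) := by
    ext q
    simp only [mem_preimage, mem_Iio, mem_union, mem_inter_iff, mem_compl_iff, mem_ofPred_eq,
      ne_iff, bdd_iff]
    by_cases hq : (A q).Nonempty ∧ BddBelow (A q)
    · simp only [hq, and_self, not_true_eq_false, false_and, or_false, true_and]
      rw [csInf_lt_iff hq.2 hq.1]
      constructor
      · rintro ⟨s, hs, hsc⟩
        obtain ⟨r, hr, hrc⟩ := exists_rat_btwn hsc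
        exact ⟨r, hrc, hup q hr.le hs⟩
      · rintro ⟨r, hrc, hr⟩
        exact ⟨r, hr, hrc⟩
    · have h0 : sInf (A q) = 0 := by
        rcases not_and_or.1 hq with h | h
        · rw [not_nonempty_iff_eq_empty.1 h, Real.sInf_empty]
        · exact Real.sInf_of_not_bddBelow h
      simp [hq, h0]
  rw [this]
  exact ((hin.inter hout).inter (hlt c)).union ((hin.inter hout).compl.inter (MeasurableSet.const _))

section Family

variable {P : Type} [MeasurableSpace P]

theorem measurable_idFun {F : P → ℝ → ℝ} (hF : Measurable (Function.uncurry F))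
    (hint : ∀ p, Integrable (F p)) (h0 : ∀ p s, 0 ≤ F p s) :
    Measurable fun q : P × ℝ => idFun (F q.1) q.2 := by
  refine measurable_sInf_of_isUpperSet (fun q s s' h hs => ?_) fun s => ?_
  · exact lt_of_lt_of_le hs (cdf_mono (hint q.1) (h0 q.1) h)
  · have h1 : Measurable fun p => ∫ x, F p x :=
      (StronglyMeasurable.integral_prod_right (f := F) (ν := volume) hF.stronglyMeasurable).measurable
    have h2 : Measurable fun p => ∫ x in Iic s, F p x :=
      (StronglyMeasurable.integral_prod_right (f := F) (ν := volume.restrict (Iic s))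
        hF.stronglyMeasurable).measurable
    exact measurableSet_lt (measurable_snd.mul (h1.comp measurable_fst)) (h2.comp measurable_fst)

/-- A family of unconditional bodies depending measurably on a parameter. -/
structure IsBodyFamily {n : ℕ} (K : P → Set (Fin n → ℝ)) : Prop where
  body : ∀ p, IsUncondBody (K p)
  meas : MeasurableSet {q : P × (Fin n → ℝ) | q.2 ∈ K q.1}

namespace IsBodyFamily

variable {n : ℕ} {K L : P → Set (Fin (n + 1) → ℝ)}

theorem measurable_secVol (h : IsBodyFamily K) :
    Measurable fun q : P × ℝ => secVol (K q.1) q.2 := by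
  have hm : Measurable fun z : (P × ℝ) × (Fin n → ℝ) =>
      (z.1.1, (Fin.cons z.1.2 z.2 : Fin (n + 1) → ℝ)) :=
    (measurable_fst.comp measurable_fst).prodMk
      (continuous_cons.measurable.comp
        ((measurable_snd.comp measurable_fst).prodMk measurable_snd))
  have hs : Measurable (Function.uncurry fun (q : P × ℝ) (y : Fin n → ℝ) =>
      charFn (K q.1) (Fin.cons q.2 y)) :=
    (measurable_const (a := (1 : ℝ))).indicator (hm h.meas)
  exact (StronglyMeasurable.integral_prod_right (ν := volume) hs.stronglyMeasurable).measurable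

theorem measurable_firstId (h : IsBodyFamily K) :
    Measurable fun q : P × ℝ => firstId (K q.1) q.2 :=
  measurable_idFun (F := fun p => secVol (K p)) h.measurable_secVol
    (fun p => (h.body p).isProfile.int) fun p => (h.body p).isProfile.nonneg

theorem measurable_slope (h : IsBodyFamily K) :
    Measurable fun q : P × ℝ =>
      (∫ x, secVol (K q.1) x) / secVol (K q.1) (firstId (K q.1) q.2) := by
  have h1 : Measurable fun p => ∫ x, secVol (K p) x :=
    (StronglyMeasurable.integral_prod_right (f := fun p => secVol (K p)) (ν := volume)
      h.measurable_secVol.stronglyMeasurable).measurable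
  exact (h1.comp measurable_fst).div
    (h.measurable_secVol.comp (measurable_fst.prodMk h.measurable_firstId))

theorem measurable_firstPot (hK : IsBodyFamily K) (hL : IsBodyFamily L) (lam : ℝ) :
    Measurable fun q : P × Ioo (0 : ℝ) 1 => firstPot lam (K q.1) (L q.1) q.2 := by
  -- The explicit quotient is jointly measurable and agrees with the derivative on `(0, 1)`.
  set g : P → ℝ → ℝ := fun p s =>
    ((∫ x, secVol (K p) x) / secVol (K p) (firstId (K p) s)) ^ (1 - lam) *
      ((∫ x, secVol (L p) x) / secVol (L p) (firstId (L p) s)) ^ lam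
  have gm : Measurable (Function.uncurry g) :=
    (hK.measurable_slope.pow_const _).mul (hL.measurable_slope.pow_const _)
  have gm' : Measurable fun z : (P × Ioo (0 : ℝ) 1) × ℝ => g z.1.1 z.2 :=
    gm.comp ((measurable_fst.comp measurable_fst).prodMk measurable_snd)
  have ht : Measurable fun z : (P × Ioo (0 : ℝ) 1) × ℝ => (z.1.2 : ℝ) :=
    measurable_subtype_coe.comp (measurable_snd.comp measurable_fst)
  -- Moving endpoints are absorbed into indicators, so only integrals over the whole line with a
  -- parameter remain.
  have e : (fun q : P × Ioo (0 : ℝ) 1 => firstPot lam (K q.1) (L q.1) q.2) = fun q =>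
      (∫ s, (Ioc (1 / 2) (q.2 : ℝ)).indicator (g q.1) s) -
        ∫ s, (Ioc (q.2 : ℝ) (1 / 2)).indicator (g q.1) s := by
    funext q
    rw [integral_indicator measurableSet_Ioc, integral_indicator measurableSet_Ioc]
    refine intervalIntegral.integral_congr fun s hs => ?_
    have hs' := uIcc_half_subset q.2.2 hs
    change geomDeriv (secVol (K q.1)) (secVol (L q.1)) lam s = g q.1 s
    rw [geomDeriv, (hK.body q.1).isProfile.deriv_idFun hs',
      (hL.body q.1).isProfile.deriv_idFun hs']
    rfl
  rw [e]
  have m1 : Measurable (Function.uncurry fun (q : P × Ioo (0 : ℝ) 1) (s : ℝ) =>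
      (Ioc (1 / 2) (q.2 : ℝ)).indicator (g q.1) s) :=
    gm'.indicator ((measurableSet_lt measurable_const measurable_snd).inter
      (measurableSet_le measurable_snd ht))
  have m2 : Measurable (Function.uncurry fun (q : P × Ioo (0 : ℝ) 1) (s : ℝ) =>
      (Ioc (q.2 : ℝ) (1 / 2)).indicator (g q.1) s) :=
    gm'.indicator ((measurableSet_lt ht measurable_snd).inter
      (measurableSet_le measurable_snd measurable_const))
  exact (StronglyMeasurable.integral_prod_right (ν := volume) m1.stronglyMeasurable).measurable.sub
    (StronglyMeasurable.integral_prod_right (ν := volume) m2.stronglyMeasurable).measurable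

/-- The coordinate `t` joins the parameter space, as a point of the open interval so that the
section is still a body. This feeds the induction in `measurable_bodyPot_family`. -/
theorem sec (h : IsBodyFamily K) :
    IsBodyFamily fun q : P × Ioo (0 : ℝ) 1 => sec (K q.1) (firstId (K q.1) q.2) where
  body q := (h.body q.1).sec_firstId q.2.2
  meas := by
    have hu : Measurable fun z : (P × Ioo (0 : ℝ) 1) × (Fin n → ℝ) =>
        firstId (K z.1.1) (z.1.2 : ℝ) :=
      h.measurable_firstId.comp ((measurable_fst.comp measurable_fst).prodMk
        (measurable_subtype_coe.comp (measurable_snd.comp measurable_fst)))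
    exact ((measurable_fst.comp measurable_fst).prodMk
      (continuous_cons.measurable.comp (hu.prodMk measurable_snd))) h.meas

end IsBodyFamily

theorem measurable_bodyPot_family (lam : ℝ) : ∀ {n : ℕ} {P : Type} [MeasurableSpace P]
    {K L : P → Set (Fin n → ℝ)} (_ : IsBodyFamily K) (_ : IsBodyFamily L),
    Measurable fun q : P × (Fin n → Ioo (0 : ℝ) 1) =>
      bodyPot lam (K q.1) (L q.1) fun i => (q.2 i : ℝ) := by
  intro n
  induction n with
  | zero => exact fun _ _ => measurable_pi_iff.2 fun i => i.elim0
  | succ n ih =>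
    intro P _ K L hK hL
    have ih := ih hK.sec hL.sec
    have h0 : Measurable fun q : P × (Fin (n + 1) → Ioo (0 : ℝ) 1) => (q.1, q.2 0) :=
      measurable_fst.prodMk ((measurable_pi_apply 0).comp measurable_snd)
    have ht : Measurable fun q : P × (Fin (n + 1) → Ioo (0 : ℝ) 1) => fun i : Fin n => q.2 i.succ :=
      measurable_pi_iff.2 fun i => (measurable_pi_apply i.succ).comp measurable_snd
    simp only [bodyPot_succ]
    exact continuous_cons.measurable.comp
      (((hK.measurable_firstPot hL lam).comp h0).prodMk (ih.comp (h0.prodMk ht)))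

end Family

/-! ### Measurability and volume of the combination -/

section Volume

variable {n : ℕ}

theorem isBodyFamily_const {K : Set (Fin n → ℝ)} (hK : IsUncondBody K) :
    IsBodyFamily fun _ : ℝ => K :=
  ⟨fun _ => hK, hK.measurableSet.preimage measurable_snd⟩

theorem measurable_of_measurable_comp_snd {α β : Type*} [MeasurableSpace α] [MeasurableSpace β]
    {f : α → β} (h : Measurable fun q : ℝ × α => f q.2) : Measurable f :=
  h.comp (measurable_prodMk_left (x := (0 : ℝ)))

theorem measurable_bodyPot (lam : ℝ) {K L : Set (Fin n → ℝ)} (hK : IsUncondBody K)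
    (hL : IsUncondBody L) :
    Measurable fun t : Fin n → Ioo (0 : ℝ) 1 => bodyPot lam K L fun i => (t i : ℝ) :=
  measurable_of_measurable_comp_snd
    (measurable_bodyPot_family (K := fun _ : ℝ => K) (L := fun _ : ℝ => L) lam
      (isBodyFamily_const hK) (isBodyFamily_const hL))

/-- The potential is triangular, and strictly increasing in each diagonal variable. -/
theorem injOn_bodyPot (lam : ℝ) : ∀ {n : ℕ} {K L : Set (Fin n → ℝ)} (_ : IsUncondBody K)
    (_ : IsUncondBody L), InjOn (bodyPot lam K L) (unitCube n)
  | 0, _, _, _, _ => fun _ _ _ _ _ => Subsingleton.elim _ _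
  | n + 1, K, L, hK, hL => by
    intro t ht t' ht' h
    rw [bodyPot_succ, bodyPot_succ] at h
    obtain ⟨h1, h2⟩ := Fin.cons_inj.1 h
    have h0 : t 0 = t' 0 :=
      (stdPrimitive_strictMonoOn hK.isProfile hL.isProfile lam).injOn (ht 0) (ht' 0) h1
    rw [← h0] at h2
    have h3 := injOn_bodyPot lam (hK.sec_firstId (ht 0)) (hL.sec_firstId (ht 0))
      (x₁ := Fin.tail t) (x₂ := Fin.tail t')
      (fun i => ht i.succ) (fun i => ht' i.succ) h2
    rw [← Fin.cons_self_tail t, ← Fin.cons_self_tail t', h0, h3]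

/-- Lusin–Souslin: an injective measurable image of a Polish space, here the open cube, is Borel. -/
theorem measurableSet_setComb (lam : ℝ) {K L : Set (Fin n → ℝ)} (hK : IsUncondBody K)
    (hL : IsUncondBody L) : MeasurableSet (setComb lam K L) := by
  have : setComb lam K L =
      range fun t : Fin n → Ioo (0 : ℝ) 1 => bodyPot lam K L fun i => (t i : ℝ) := by
    rw [setComb_eq_image hK hL]
    ext x
    constructor
    · rintro ⟨t, ht, rfl⟩; exact ⟨fun i => ⟨t i, ht i⟩, rfl⟩
    · rintro ⟨t, rfl⟩; exact ⟨_, fun i => (t i).2, rfl⟩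
  rw [this]
  have : PolishSpace (Ioo (0 : ℝ) 1) := isOpen_Ioo.polishSpace
  refine ((measurable_bodyPot lam hK hL).measurableEmbedding fun t t' h => ?_).measurableSet_range
  have := injOn_bodyPot lam hK hL (fun i => (t i).2) (fun i => (t' i).2) h
  funext i
  exact Subtype.ext (congrFun this i)

theorem sec_setComb {lam : ℝ} {K L : Set (Fin (n + 1) → ℝ)} (hK : IsUncondBody K)
    (hL : IsUncondBody L) {t : ℝ} (ht : t ∈ Ioo (0 : ℝ) 1) :
    sec (setComb lam K L) (firstPot lam K L t) =
      setComb lam (sec K (firstId K t)) (sec L (firstId L t)) := by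
  ext y
  change Fin.cons (firstPot lam K L t) y ∈ setComb lam K L ↔ _
  rw [mem_setComb_succ hK hL]
  simp only [Fin.cons_zero, Fin.tail_cons]
  constructor
  · rintro ⟨t', ht', h, hy⟩
    rwa [(stdPrimitive_strictMonoOn hK.isProfile hL.isProfile lam).injOn ht' ht h] at hy
  · exact fun hy => ⟨t, ht, rfl, hy⟩

/-- The derivative of an inverse distribution function times the section volume is the total volume;
this is raised to the two powers and multiplied. -/
theorem ofReal_geomDeriv_mul {lam : ℝ} (hlam : lam ∈ Icc (0 : ℝ) 1)
    {K L : Set (Fin (n + 1) → ℝ)} (hK : IsUncondBody K)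
    (hL : IsUncondBody L) {t : ℝ} (ht : t ∈ Ioo (0 : ℝ) 1) :
    ENNReal.ofReal |geomDeriv (secVol K) (secVol L) lam t| *
      (volume (sec K (firstId K t)) ^ (1 - lam) * volume (sec L (firstId L t)) ^ lam) =
      volume K ^ (1 - lam) * volume L ^ lam := by
  have pK := hK.isProfile.pos _ (hK.isProfile.idFun_mem ht)
  have pL := hL.isProfile.pos _ (hL.isProfile.idFun_mem ht)
  have iK := hK.isProfile.integral_pos
  have iL := hL.isProfile.integral_pos
  rw [abs_of_pos (geomDeriv_pos hK.isProfile hL.isProfile lam ht), ← hK.ofReal_secVol,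
    ← hL.ofReal_secVol, ← hK.ofReal_integral_secVol, ← hL.ofReal_integral_secVol, geomDeriv,
    hK.isProfile.deriv_idFun ht, hL.isProfile.deriv_idFun ht, firstId, firstId,
    ENNReal.ofReal_mul (by positivity), ← ENNReal.ofReal_rpow_of_pos (div_pos iK pK),
    ← ENNReal.ofReal_rpow_of_pos (div_pos iL pL), mul_mul_mul_comm,
    ← ENNReal.mul_rpow_of_nonneg _ _ (sub_nonneg.2 hlam.2),
    ← ENNReal.mul_rpow_of_nonneg _ _ hlam.1, ← ENNReal.ofReal_mul (by positivity),
    ← ENNReal.ofReal_mul (by positivity), div_mul_cancel₀ _ pK.ne', div_mul_cancel₀ _ pL.ne']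

theorem volume_setComb {lam : ℝ} (hlam : lam ∈ Icc (0 : ℝ) 1) :
    ∀ {n : ℕ} {K L : Set (Fin n → ℝ)} (_ : IsUncondBody K) (_ : IsUncondBody L),
      volume (setComb lam K L) = volume K ^ (1 - lam) * volume L ^ lam
  | 0, K, L, hK, hL => by
    have hC : (setComb lam K L).Nonempty := by
      rw [setComb_eq_image hK hL]
      exact ⟨_, Fin.elim0, fun i => i.elim0, rfl⟩
    obtain ⟨r, -, hr⟩ := hK.pos
    obtain ⟨r', -, hr'⟩ := hL.pos
    rw [Subsingleton.eq_univ_of_nonempty hC, Subsingleton.eq_univ_of_nonempty ⟨_, hr⟩,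
      Subsingleton.eq_univ_of_nonempty ⟨_, hr'⟩]
    simp [volume_pi]
  | n + 1, K, L, hK, hL => by
    have hmono : StrictMonoOn (firstPot lam K L) (Ioo 0 1) :=
      stdPrimitive_strictMonoOn hK.isProfile hL.isProfile lam
    have hderiv : ∀ t ∈ Ioo (0 : ℝ) 1,
        HasDerivAt (firstPot lam K L) (geomDeriv (secVol K) (secVol L) lam t) t :=
      fun t ht => hasDerivAt_stdPrimitive hK.isProfile hL.isProfile lam ht
    have himg : MeasurableSet (firstPot lam K L '' Ioo 0 1) :=
      measurableSet_Ioo.image_of_continuousOn_injOn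
        (fun t ht => (hderiv t ht).continuousAt.continuousWithinAt) hmono.injOn
    -- Off the range of the first component of the potential, the sections of the combination are
    -- empty.
    have hsupp : ∫⁻ s, volume (sec (setComb lam K L) s) =
        ∫⁻ s in firstPot lam K L '' Ioo 0 1, volume (sec (setComb lam K L) s) := by
      rw [← lintegral_indicator himg]
      refine lintegral_congr fun s => ?_
      by_cases hs : s ∈ firstPot lam K L '' Ioo 0 1
      · rw [indicator_of_mem hs]
      · rw [indicator_of_notMem hs]
        refine measure_mono_null (fun y hy => ?_) measure_empty
        obtain ⟨t, ht, h0, -⟩ := (mem_setComb_succ hK hL).1 hy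
        exact hs ⟨t, ht, h0⟩
    rw [volume_eq_lintegral (measurableSet_setComb lam hK hL), hsupp,
      lintegral_image_eq_lintegral_abs_deriv_mul measurableSet_Ioo
        (fun t ht => (hderiv t ht).hasDerivWithinAt) hmono.injOn,
      setLIntegral_congr_fun (g := fun _ => volume K ^ (1 - lam) * volume L ^ lam)
        measurableSet_Ioo fun t ht => ?_]
    · simp
    · simp only
      rw [sec_setComb hK hL ht, volume_setComb hlam (hK.sec_firstId ht) (hL.sec_firstId ht),
        ofReal_geomDeriv_mul hlam hK hL ht]

end Volume

end GeomComb

end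

theorem proposition3p5 (n : ℕ) (K L : ConvexBody (Fin n → ℝ))
    (hKint : (interior (K : Set (Fin n → ℝ))).Nonempty)
    (hLint : (interior (L : Set (Fin n → ℝ))).Nonempty)
    (hK : GeomComb.Unconditional (K : Set (Fin n → ℝ)))
    (hL : GeomComb.Unconditional (L : Set (Fin n → ℝ)))
    (lam : ℝ) (hlam : lam ∈ Set.Icc (0 : ℝ) 1) :
    -- the standard geometric combination is unconditional
    GeomComb.Unconditional (GeomComb.setComb lam (K : Set (Fin n → ℝ)) L) ∧
    -- it is contained in the product body, and hence in the 0-sum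
    GeomComb.setComb lam (K : Set (Fin n → ℝ)) L ⊆ GeomComb.productBody lam K L ∧
    GeomComb.productBody lam (K : Set (Fin n → ℝ)) L ⊆ GeomComb.zeroSum lam K L ∧
    GeomComb.setComb lam (K : Set (Fin n → ℝ)) L ⊆ GeomComb.zeroSum lam K L ∧
    -- it is Lebesgue measurable and its volume is the geometric mean of the volumes
    MeasureTheory.NullMeasurableSet (GeomComb.setComb lam (K : Set (Fin n → ℝ)) L)
      MeasureTheory.volume ∧
    MeasureTheory.volume (GeomComb.setComb lam (K : Set (Fin n → ℝ)) L) =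
      MeasureTheory.volume (K : Set (Fin n → ℝ)) ^ (1 - lam) *
        MeasureTheory.volume (L : Set (Fin n → ℝ)) ^ lam ∧
    -- the log-Brunn-Minkowski inequality
    MeasureTheory.volume (K : Set (Fin n → ℝ)) ^ (1 - lam) *
        MeasureTheory.volume (L : Set (Fin n → ℝ)) ^ lam ≤
      MeasureTheory.volume (GeomComb.zeroSum lam (K : Set (Fin n → ℝ)) L) := by
  have bK := GeomComb.isUncondBody_of_convexBody K hKint hK
  have bL := GeomComb.isUncondBody_of_convexBody L hLint hL
  have h1 := GeomComb.setComb_subset_productBody hlam bK bL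
  have h2 := GeomComb.productBody_subset_zeroSum hlam bK bL
  have hvol := GeomComb.volume_setComb hlam bK bL
  exact ⟨GeomComb.unconditional_setComb lam bK bL, h1, h2, h1.trans h2,
    (GeomComb.measurableSet_setComb lam bK bL).nullMeasurableSet, hvol,
    hvol ▸ MeasureTheory.measure_mono (h1.trans h2)⟩
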